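/- There exist a map $f:\mathbb{R}^2\to\{1,2,3,4,5\}\cup\{\ast\}$ (a partial 5-coloring of the plane, where $f(x)=\ast$ means that the point $x$ is removed), linearly independent vectors $v,w\in\mathbb{R}^2$ and integers $k,l\ge 1$ with the following properties. 1. No two points of the plane at Euclidean distance exactly $1$ carry the same one of the five colors: if $f(x)=f(y)\in\{1,\dots,5\}$, then $\|x-y\|\ne 1$. 2. $f$ is periodic with respect to the lattice $\mathbb{Z}v+\mathbb{Z}w$, i.e. $f(x+v)=f(x+w)=f(x)$ for all $x\in\mathbb{R}^2$, and $f$ is constant on each of the half-open parallelogram cells $\left\{\frac{i+\alpha}{k}v+\frac{j+\beta}{l}w:\alpha,\beta\in[0,1)\right\}$, $i,j\in\mathbb{Z}$. 3. The set $\{x\in\mathbb{R}^2: f(x)=\ast\}$ of removed points has an asymptotic density of at most $3.7356\%$: with $\lambda$ the Lebesgue measure and $B_R$ the disc of radius $R$ about the origin, the limit $$\lim_{R\to\infty}\frac{\lambda(\{x\in B_R: f(x)=\ast\})}{\lambda(B_R)}$$ exists and is at most $0.037356$. -/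

import Mathlib

open Filter Topology MeasureTheory

/-- The Euclidean plane. -/
abbrev Plane : Type := EuclideanSpace ℝ (Fin 2)

/-- `S` has (asymptotic area) density `d`: the fraction of the disc of radius `R` about the
origin that is covered by `S` tends to `d` as `R → ∞`. -/
def HasDensity (S : Set Plane) (d : ℝ) : Prop :=
  Tendsto (fun R : ℝ =>
    volume.real (S ∩ Metric.ball (0 : Plane) R) / volume.real (Metric.ball (0 : Plane) R))
    atTop (𝓝 d)

/-- A partial coloring of the plane with `c` colors; the value `none` means that the point is
removed (left uncolored). -/
abbrev PartialColoring (c : ℕ) : Type := Plane → Option (Fin c)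

/-- The set of points that are removed. -/
def PartialColoring.removed {c : ℕ} (f : PartialColoring c) : Set Plane :=
  {x | f x = none}

/-- No two points at distance exactly one carry the same one of the `c` colors. -/
def PartialColoring.AvoidsUnitDistance {c : ℕ} (f : PartialColoring c) : Prop :=
  ∀ (a : Fin c) (x y : Plane), f x = some a → f y = some a → dist x y ≠ 1

/-- The parallelogram `𝒫 = {α v + β w : α, β ∈ [0, 1)}`, subdivided into `k * l` congruent
half-open cells with sides `v / k` and `w / l`, and translated by the lattice `ℤ v + ℤ w`, gives
a tiling of the plane. This is the cell of that tiling with index `(i, j)`. -/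
def parallelogramCell (v w : Plane) (k l : ℕ) (i j : ℤ) : Set Plane :=
  {x | ∃ α ∈ Set.Ico (0 : ℝ) 1, ∃ β ∈ Set.Ico (0 : ℝ) 1,
    x = (((i : ℝ) + α) / k) • v + (((j : ℝ) + β) / l) • w}

/-- `f` is periodic with respect to the lattice `ℤ v + ℤ w`. -/
def PartialColoring.IsPeriodic {c : ℕ} (f : PartialColoring c) (v w : Plane) : Prop :=
  ∀ x : Plane, f (x + v) = f x ∧ f (x + w) = f x

/-- `f` is constant on each cell of the subdivision of the fundamental parallelogram and of all
its lattice translates. -/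
def PartialColoring.IsConstantOnCells {c : ℕ} (f : PartialColoring c) (v w : Plane)
    (k l : ℕ) : Prop :=
  ∀ i j : ℤ, ∀ x ∈ parallelogramCell v w k l i j, ∀ y ∈ parallelogramCell v w k l i j, f x = f y

/-! The coloring comes from an explicit periodic arrangement of ten polygonal tiles, two for each
color, with periods 1.97148 and 3.34494. Every tile has diameter less than 1, two tiles of the same
color (lattice translates included) are more than 1 apart, and tiles of different colors do not
overlap. Hence the open color classes avoid distance 1, and the uncolored part is what the tiles
leave free in a fundamental rectangle, which is less than 3.7356% of its area.

All coordinates are integers in units of 1/100000, so the geometry becomes a finite computation. A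
tile is a stack of trapezoids; containment in a convex set may be tested at vertices
(`tile_subset`). Discs then bound diameters, and half-planes together with Cauchy–Schwarz bound
distances between tiles (`SeparatedBy.isFar`). Areas add up because the pieces are disjoint
(`volume_tile`, `volume_box_inter_translates`).

The color classes are not unions of parallelogram cells. A fine grid compatible with the periods
repairs this: only cells inside a color class keep a color. Since the classes are open, the lost
area tends to 0 with the mesh, and the strict area inequality absorbs it (`exists_cell_coloring`).
Density equals the proportion in a fundamental rectangle (`hasDensity_of_periodic`). -/

/-! ### Rectangular lattices and the density of periodic sets -/

/-- The vector `(i * a, j * b)` of the rectangular lattice with periods `a` and `b`. -/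
noncomputable def latticeVec (a b : ℝ) (n : ℤ × ℤ) : Plane := !₂[n.1 * a, n.2 * b]

@[simp] theorem latticeVec_zero_apply (a b : ℝ) (n : ℤ × ℤ) : latticeVec a b n 0 = n.1 * a := by
  simp [latticeVec]

@[simp] theorem latticeVec_one_apply (a b : ℝ) (n : ℤ × ℤ) : latticeVec a b n 1 = n.2 * b := by
  simp [latticeVec]

/-- The half-open rectangle `[0, a) × [0, b)`. -/
def box (a b : ℝ) : Set Plane := {x | x 0 ∈ Set.Ico 0 a ∧ x 1 ∈ Set.Ico 0 b}

theorem measurableSet_box (a b : ℝ) : MeasurableSet (box a b) := by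
  have h (i : Fin 2) : Measurable fun x : Plane => x i := by fun_prop
  exact (h 0 measurableSet_Ico).inter (h 1 measurableSet_Ico)

theorem plane_ext {x y : Plane} (h0 : x 0 = y 0) (h1 : x 1 = y 1) : x = y := by
  ext i; fin_cases i <;> assumption

/-- The identification of the plane with `ℝ × ℝ`. -/
noncomputable def planeEquiv : Plane ≃ᵐ ℝ × ℝ :=
  (MeasurableEquiv.toLp 2 (Fin 2 → ℝ)).symm.trans MeasurableEquiv.finTwoArrow

@[simp] theorem planeEquiv_apply (x : Plane) : planeEquiv x = (x 0, x 1) := rfl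

theorem measurePreserving_planeEquiv : MeasurePreserving planeEquiv volume volume :=
  (volume_preserving_finTwoArrow ℝ).comp
    (EuclideanSpace.volume_preserving_symm_measurableEquiv_toLp (Fin 2))

theorem volume_box {a b : ℝ} (ha : 0 ≤ a) : volume (box a b) = ENNReal.ofReal (a * b) := by
  have h : box a b = planeEquiv ⁻¹' (Set.Ico 0 a ×ˢ Set.Ico 0 b) := by
    ext x; simp [box]
  rw [h, measurePreserving_planeEquiv.measure_preimage_equiv, Measure.volume_eq_prod,
    Measure.prod_prod, Real.volume_Ico, Real.volume_Ico, sub_zero, sub_zero,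
    ENNReal.ofReal_mul ha]

/-- The index of the lattice translate of `box a b` containing `x`. -/
noncomputable def latticeIndex (a b : ℝ) (x : Plane) : ℤ × ℤ := (⌊x 0 / a⌋, ⌊x 1 / b⌋)

theorem sub_latticeVec_mem_box_iff {a b : ℝ} (ha : 0 < a) (hb : 0 < b) (x : Plane) (n : ℤ × ℤ) :
    x - latticeVec a b n ∈ box a b ↔ latticeIndex a b x = n := by
  have key (t s : ℝ) (hs : 0 < s) (k : ℤ) : t - k * s ∈ Set.Ico 0 s ↔ ⌊t / s⌋ = k := by
    rw [Int.floor_eq_iff, le_div_iff₀ hs, div_lt_iff₀ hs, Set.mem_Ico]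
    constructor <;> rintro ⟨h1, h2⟩ <;> constructor <;> linarith
  rw [Prod.ext_iff]
  simp only [box, latticeIndex, Set.mem_ofPred_eq, PiLp.sub_apply, latticeVec_zero_apply,
    latticeVec_one_apply, key _ a ha, key _ b hb]

/-- Cutting a set along the lattice translates of the fundamental rectangle. -/
theorem volume_eq_tsum_box {a b : ℝ} (ha : 0 < a) (hb : 0 < b) {s : Set Plane}
    (hs : MeasurableSet s) :
    volume s = ∑' n : ℤ × ℤ, volume {x | x ∈ box a b ∧ x + latticeVec a b n ∈ s} := by
  have hm (n : ℤ × ℤ) : MeasurableSet {x : Plane | x - latticeVec a b n ∈ box a b} :=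
    (measurable_id.sub_const _) (measurableSet_box a b)
  have hu : s = ⋃ n : ℤ × ℤ, s ∩ {x | x - latticeVec a b n ∈ box a b} := by
    rw [← Set.inter_iUnion, Set.inter_eq_left.2]
    intro x _
    exact Set.mem_iUnion.2 ⟨_, (sub_latticeVec_mem_box_iff ha hb x _).2 rfl⟩
  conv_lhs => rw [hu]
  rw [measure_iUnion _ fun n => hs.inter (hm n)]
  · refine tsum_congr fun n => ?_
    rw [← measure_preimage_add_right volume (latticeVec a b n)]
    congr 1
    ext x
    simp [and_comm]
  · intro m n hmn
    refine Set.disjoint_left.2 fun x hx hy => hmn ?_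
    rw [← (sub_latticeVec_mem_box_iff ha hb x m).1 hx.2,
      (sub_latticeVec_mem_box_iff ha hb x n).1 hy.2]

theorem dist_lt_of_mem_box {a b : ℝ} {x y : Plane} (hx : x ∈ box a b) (hy : y ∈ box a b) :
    dist x y < a + b := by
  obtain ⟨⟨h1, h2⟩, h3, h4⟩ := hx
  obtain ⟨⟨h5, h6⟩, h7, h8⟩ := hy
  rw [EuclideanSpace.dist_eq, Fin.sum_univ_two, Real.dist_eq, Real.dist_eq, sq_abs, sq_abs,
    Real.sqrt_lt' (by linarith)]
  have ha : |x 0 - y 0| < a := abs_lt.2 ⟨by linarith, by linarith⟩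
  have hb : |x 1 - y 1| < b := abs_lt.2 ⟨by linarith, by linarith⟩
  rw [← sq_abs (x 0 - y 0), ← sq_abs (x 1 - y 1)]
  nlinarith [abs_nonneg (x 0 - y 0), abs_nonneg (x 1 - y 1)]

/-- A translate of the box that meets the ball of radius `R` lies in the ball of radius `R + (a +
b)`, as the box has diameter at most `a + b`. Comparing box by box gives the bound. -/
theorem volume_inter_ball_le {a b : ℝ} (ha : 0 < a) (hb : 0 < b) {s : Set Plane}
    (hs : MeasurableSet s) (hper : ∀ n x, x + latticeVec a b n ∈ s ↔ x ∈ s) {d : ENNReal}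
    (hd : volume (box a b ∩ s) ≤ d * volume (box a b)) (R : ℝ) :
    volume (s ∩ Metric.ball 0 R) ≤ d * volume (Metric.ball (0 : Plane) (R + (a + b))) := by
  rw [volume_eq_tsum_box ha hb (hs.inter measurableSet_ball),
    volume_eq_tsum_box ha hb measurableSet_ball, ← ENNReal.tsum_mul_left]
  refine ENNReal.tsum_le_tsum fun n => ?_
  rcases Set.eq_empty_or_nonempty
    {x | x ∈ box a b ∧ x + latticeVec a b n ∈ s ∩ Metric.ball 0 R} with h | ⟨y, hy⟩
  · rw [h, measure_empty]; exact zero_le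
  · have h1 : {x | x ∈ box a b ∧ x + latticeVec a b n ∈ s ∩ Metric.ball 0 R} ⊆ box a b ∩ s :=
      fun x hx => ⟨hx.1, (hper n x).1 hx.2.1⟩
    have h2 : box a b ⊆
        {x | x ∈ box a b ∧ x + latticeVec a b n ∈ Metric.ball (0 : Plane) (R + (a + b))} := by
      intro x hx
      refine ⟨hx, ?_⟩
      have h3 := dist_lt_of_mem_box hx hy.1
      have h4 : dist (y + latticeVec a b n) 0 < R := hy.2.2
      have h5 := dist_triangle (x + latticeVec a b n) (y + latticeVec a b n) 0
      rw [dist_add_right] at h5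
      rw [Metric.mem_ball]
      linarith
    calc _ ≤ _ := measure_mono h1
      _ ≤ _ := hd
      _ ≤ _ := by gcongr

theorem volume_real_ball_plane {R : ℝ} (hR : 0 ≤ R) :
    volume.real (Metric.ball (0 : Plane) R) = Real.pi * R ^ 2 := by
  rw [Measure.real, EuclideanSpace.volume_ball_fin_two, ENNReal.toReal_mul, ENNReal.toReal_pow,
    ENNReal.toReal_ofReal hR]
  simp [mul_comm, Real.pi_nonneg]

/-- The density of a periodic set is the fraction of the fundamental rectangle that it covers. -/
theorem hasDensity_of_periodic {a b : ℝ} (ha : 0 < a) (hb : 0 < b) {s : Set Plane}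
    (hs : MeasurableSet s) (hper : ∀ n x, x + latticeVec a b n ∈ s ↔ x ∈ s) :
    HasDensity s (volume.real (box a b ∩ s) / volume.real (box a b)) := by
  have hbox : volume.real (box a b) = a * b := by
    rw [Measure.real, volume_box ha.le, ENNReal.toReal_ofReal (by positivity)]
  have hfin : volume (box a b) ≠ ⊤ := by rw [volume_box ha.le]; exact ENNReal.ofReal_ne_top
  -- Stated for a general set because it is applied both to `s` and to its complement; the
  -- complement supplies the lower bound for `s`.
  have upper (t : Set Plane) (ht : MeasurableSet t)
      (hp : ∀ n x, x + latticeVec a b n ∈ t ↔ x ∈ t) (R : ℝ) :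
      volume.real (t ∩ Metric.ball 0 R) ≤ volume.real (box a b ∩ t) / volume.real (box a b) *
        volume.real (Metric.ball (0 : Plane) (R + (a + b))) := by
    have h := volume_inter_ball_le ha hb ht hp
      (d := volume (box a b ∩ t) / volume (box a b)) (by
        rw [ENNReal.div_mul_cancel _ hfin]
        rw [volume_box ha.le]
        simp; positivity) R
    have h' := ENNReal.toReal_mono (ENNReal.mul_ne_top (ENNReal.div_ne_top
      (measure_ne_top_of_subset Set.inter_subset_left hfin) (by
        rw [volume_box ha.le]
        simp; positivity)) measure_ball_lt_top.ne) h
    rwa [ENNReal.toReal_mul, ENNReal.toReal_div] at h'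
  set d := volume.real (box a b ∩ s) / volume.real (box a b) with hd
  have hcompl : volume.real (box a b ∩ sᶜ) / volume.real (box a b) = 1 - d := by
    have h := measureReal_inter_add_sdiff (μ := volume) (s := box a b) hs hfin
    rw [hd, eq_sub_iff_add_eq, ← add_div, ← Set.sdiff_eq, add_comm, h, hbox,
      div_self (by positivity)]
  have hlim : Tendsto (fun R : ℝ => (R + (a + b)) ^ 2 / R ^ 2) atTop (𝓝 1) := by
    have h : Tendsto (fun R : ℝ => (1 + (a + b) / R) ^ 2) atTop (𝓝 ((1 + 0) ^ 2)) :=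
      ((tendsto_const_nhds.div_atTop tendsto_id).const_add 1).pow 2
    rw [add_zero, one_pow] at h
    refine h.congr' ?_
    filter_upwards [eventually_gt_atTop 0] with R hR
    rw [← div_pow, add_div R, div_self hR.ne']
  have hball (R : ℝ) (hR : 0 < R) : volume.real (Metric.ball (0 : Plane) (R + (a + b))) =
      (R + (a + b)) ^ 2 / R ^ 2 * volume.real (Metric.ball (0 : Plane) R) := by
    rw [volume_real_ball_plane hR.le, volume_real_ball_plane (by positivity)]
    field_simp
  have hpos (R : ℝ) (hR : 0 < R) : 0 < volume.real (Metric.ball (0 : Plane) R) := by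
    rw [volume_real_ball_plane hR.le]; positivity
  refine tendsto_of_tendsto_of_tendsto_of_le_of_le' (g := fun R : ℝ =>
    1 - (1 - d) * ((R + (a + b)) ^ 2 / R ^ 2)) (h := fun R : ℝ => d * ((R + (a + b)) ^ 2 / R ^ 2))
    ?_ ?_ ?_ ?_
  · simpa using (hlim.const_mul (1 - d)).const_sub 1
  · simpa using hlim.const_mul d
  · filter_upwards [eventually_gt_atTop 0] with R hR
    have h1 := upper sᶜ hs.compl (fun n x => not_congr (hper n x)) R
    have h2 := measureReal_inter_add_sdiff (μ := volume) (s := Metric.ball (0 : Plane) R) hs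
      measure_ball_lt_top.ne
    rw [hcompl, hball R hR] at h1
    rw [Set.sdiff_eq, Set.inter_comm _ s, Set.inter_comm _ sᶜ] at h2
    rw [le_div_iff₀ (hpos R hR)]
    linarith
  · filter_upwards [eventually_gt_atTop 0] with R hR
    have h1 := upper s hs hper R
    rw [hball R hR] at h1
    rw [div_le_iff₀ (hpos R hR)]
    linarith

theorem measurable_latticeIndex (a b : ℝ) : Measurable (latticeIndex a b) := by
  have h (i : Fin 2) : Measurable fun x : Plane => x i := by fun_prop
  exact (((h 0).div_const a).floor).prodMk (((h 1).div_const b).floor)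

theorem latticeIndex_add_latticeVec {a b : ℝ} (ha : 0 < a) (hb : 0 < b) {N : ℕ} (hN : 0 < N)
    (x : Plane) (n : ℤ × ℤ) :
    latticeIndex (a / N) (b / N) (x + latticeVec a b n) =
      latticeIndex (a / N) (b / N) x + (n.1 * N, n.2 * N) := by
  have hN' : (0 : ℝ) < N := by exact_mod_cast hN
  have key (t s : ℝ) (hs : 0 < s) (k : ℤ) : ⌊(t + k * s) / (s / N)⌋ = ⌊t / (s / N)⌋ + k * N := by
    have : (t + k * s) / (s / N) = t / (s / N) + ((k * N : ℤ) : ℝ) := by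
      push_cast; field_simp
    rw [this, Int.floor_add_intCast]
  simp only [latticeIndex, PiLp.add_apply, latticeVec_zero_apply, latticeVec_one_apply,
    key _ a ha, key _ b hb, Prod.mk_add_mk]

theorem latticeIndex_eq_of_mem_parallelogramCell {a b : ℝ} (ha : 0 < a) (hb : 0 < b) {N : ℕ}
    (hN : 0 < N) {i j : ℤ} {x : Plane}
    (hx : x ∈ parallelogramCell (latticeVec a b (1, 0)) (latticeVec a b (0, 1)) N N i j) :
    latticeIndex (a / N) (b / N) x = (i, j) := by
  obtain ⟨α, hα, β, hβ, rfl⟩ := hx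
  have hN' : (0 : ℝ) < N := by exact_mod_cast hN
  have key (s γ : ℝ) (hs : 0 < s) (k : ℤ) (hγ : γ ∈ Set.Ico (0 : ℝ) 1) :
      ⌊(k + γ) / N * s / (s / N)⌋ = k := by
    have : (k + γ) / N * s / (s / N) = k + γ := by field_simp
    rw [this, Int.floor_eq_iff]
    exact ⟨by linarith [hγ.1], by linarith [hγ.2]⟩
  simp [latticeIndex, key a α ha i hα, key b β hb j hβ]

/-! ### Replacing open color classes by unions of grid cells -/

/-- An index satisfying `p`, if there is one. -/
noncomputable def someIndex {c : ℕ} (p : Fin c → Prop) : Option (Fin c) :=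
  open Classical in if h : ∃ k, p k then some h.choose else none

theorem someIndex_eq_none_iff {c : ℕ} {p : Fin c → Prop} : someIndex p = none ↔ ∀ k, ¬ p k := by
  by_cases h : ∃ k, p k
  · simp [someIndex, h]
  · simpa [someIndex, h] using not_exists.1 h

theorem of_someIndex_eq_some {c : ℕ} {p : Fin c → Prop} {k : Fin c} (h : someIndex p = some k) :
    p k := by
  by_cases h' : ∃ k, p k
  · rw [someIndex, dif_pos h', Option.some_inj] at h
    exact h ▸ h'.choose_spec
  · simp [someIndex, h'] at h

/-- Give a point the color `k` if its cell in the grid with cells of size `s × t` is contained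
in `U k`. -/
noncomputable def gridColoring {c : ℕ} (U : Fin c → Set Plane) (s t : ℝ) : PartialColoring c :=
  fun x => someIndex fun k => latticeIndex s t ⁻¹' {latticeIndex s t x} ⊆ U k

theorem mem_of_gridColoring_eq_some {c : ℕ} {U : Fin c → Set Plane} {s t : ℝ} {x : Plane}
    {k : Fin c} (h : gridColoring U s t x = some k) : x ∈ U k :=
  of_someIndex_eq_some h rfl

theorem gridColoring_congr {c : ℕ} (U : Fin c → Set Plane) {s t : ℝ} {x y : Plane}
    (h : latticeIndex s t x = latticeIndex s t y) :
    gridColoring U s t x = gridColoring U s t y := by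
  simp only [gridColoring, h]

theorem measurableSet_removed_gridColoring {c : ℕ} (U : Fin c → Set Plane) (s t : ℝ) :
    MeasurableSet (gridColoring U s t).removed :=
  (measurable_latticeIndex s t)
    (MeasurableSet.of_discrete (s := {m | ∀ k, ¬ latticeIndex s t ⁻¹' {m} ⊆ U k})) |>.congr <| by
      ext x
      exact someIndex_eq_none_iff.symm

/-- The mesh divides the periods, so a lattice translation shifts cell indices by multiples of `N`
and carries cells to cells. -/
theorem gridColoring_add_latticeVec {c : ℕ} {U : Fin c → Set Plane} {a b : ℝ} (ha : 0 < a)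
    (hb : 0 < b) (hper : ∀ k n x, x + latticeVec a b n ∈ U k ↔ x ∈ U k) {N : ℕ} (hN : 0 < N)
    (x : Plane) (n : ℤ × ℤ) :
    gridColoring U (a / N) (b / N) (x + latticeVec a b n) = gridColoring U (a / N) (b / N) x := by
  unfold gridColoring
  congr 1
  funext k
  refine propext ⟨fun h y hy => ?_, fun h y hy => ?_⟩
  · refine (hper k n y).1 (h ?_)
    have hy' : latticeIndex (a / N) (b / N) y = latticeIndex (a / N) (b / N) x := hy
    rw [Set.mem_preimage, Set.mem_singleton_iff, latticeIndex_add_latticeVec ha hb hN,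
      latticeIndex_add_latticeVec ha hb hN, hy']
  · rw [← sub_add_cancel y (latticeVec a b n), hper k n]
    refine h ?_
    have hy' : latticeIndex (a / N) (b / N) y =
      latticeIndex (a / N) (b / N) (x + latticeVec a b n) := hy
    rwa [← sub_add_cancel y (latticeVec a b n), latticeIndex_add_latticeVec ha hb hN,
      latticeIndex_add_latticeVec ha hb hN, add_left_inj] at hy'

theorem dist_lt_of_latticeIndex_eq {s t : ℝ} (hs : 0 < s) (ht : 0 < t) {x y : Plane}
    (h : latticeIndex s t x = latticeIndex s t y) : dist x y < s + t := by
  have h1 := (sub_latticeVec_mem_box_iff hs ht x _).2 rfl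
  have h2 := (sub_latticeVec_mem_box_iff hs ht y _).2 h.symm
  have := dist_lt_of_mem_box h1 h2
  rwa [dist_sub_right] at this

/-- Open periodic color classes that avoid the unit distance can be replaced by unions of grid
cells with an arbitrarily small loss of area. -/
theorem exists_cell_coloring {c : ℕ} {U : Fin c → Set Plane} {a b δ : ℝ} (ha : 0 < a) (hb : 0 < b)
    (hopen : ∀ k, IsOpen (U k)) (hper : ∀ k n x, x + latticeVec a b n ∈ U k ↔ x ∈ U k)
    (havoid : ∀ k, ∀ x ∈ U k, ∀ y ∈ U k, dist x y ≠ 1)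
    (hδ : volume (box a b ∩ (⋃ k, U k)ᶜ) < ENNReal.ofReal (δ * (a * b))) :
    ∃ f : PartialColoring c, f.AvoidsUnitDistance ∧
      (∃ v w : Plane, LinearIndependent ℝ ![v, w] ∧ f.IsPeriodic v w ∧
        ∃ k l : ℕ, 0 < k ∧ 0 < l ∧ f.IsConstantOnCells v w k l) ∧
      ∃ d : ℝ, HasDensity f.removed d ∧ d ≤ δ := by
  have hboxfin : volume (box a b) ≠ ⊤ := by rw [volume_box ha.le]; exact ENNReal.ofReal_ne_top
  -- `D n` bounds the removed part of the box for the grid with `n + 1` subdivisions: a removed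
  -- point shares its cell, for each `k`, with a point outside `U k`.
  let D (n : ℕ) : Set Plane :=
    box a b ∩ ⋂ k, Metric.thickening (a / (n + 1 : ℕ) + b / (n + 1 : ℕ)) (U k)ᶜ
  have hDm (n : ℕ) : NullMeasurableSet (D n) volume :=
    ((measurableSet_box a b).inter
      (MeasurableSet.iInter fun k => Metric.isOpen_thickening.measurableSet)).nullMeasurableSet
  have hDanti : Antitone D := by
    intro m n hmn
    refine Set.inter_subset_inter_right _ (Set.iInter_mono fun k => Metric.thickening_mono ?_ _)
    gcongr
  -- Openness enters here: a point of `U k` has a ball inside `U k`, so it leaves `D n` once the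
  -- mesh is small.
  have hDlim : ⋂ n, D n = box a b ∩ (⋃ k, U k)ᶜ := by
    refine Set.Subset.antisymm (fun x hx => ?_) fun x hx => ?_
    · rw [Set.mem_iInter] at hx
      refine ⟨(hx 0).1, fun hxU => ?_⟩
      obtain ⟨k, hk⟩ := Set.mem_iUnion.1 hxU
      obtain ⟨ε, hε, hball⟩ := Metric.isOpen_iff.1 (hopen k) x hk
      obtain ⟨n, hn⟩ := exists_nat_gt ((a + b) / ε)
      obtain ⟨z, hz, hxz⟩ := Metric.mem_thickening_iff.1 (Set.mem_iInter.1 (hx n).2 k)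
      refine hz (hball ?_)
      rw [Metric.mem_ball, dist_comm]
      refine hxz.trans ?_
      rw [div_lt_iff₀ hε] at hn
      rw [← add_div, div_lt_iff₀ (by positivity)]
      push_cast
      linarith
    · refine Set.mem_iInter.2 fun n => ⟨hx.1, Set.mem_iInter.2 fun k => ?_⟩
      refine Metric.self_subset_thickening (by positivity) _ fun hk => hx.2 ?_
      exact Set.mem_iUnion.2 ⟨k, hk⟩
  -- Continuity from above, with the strict inequality `hδ`, yields a mesh that is fine enough.
  have htend := tendsto_measure_iInter_atTop hDm hDanti
    ⟨0, measure_ne_top_of_subset Set.inter_subset_left hboxfin⟩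
  rw [hDlim] at htend
  obtain ⟨n, hn⟩ := (htend.eventually_lt_const hδ).exists
  have hN : 0 < n + 1 := n.succ_pos
  set f := gridColoring U (a / (n + 1 : ℕ)) (b / (n + 1 : ℕ)) with hf
  have hfper (x : Plane) (m : ℤ × ℤ) : f (x + latticeVec a b m) = f x :=
    gridColoring_add_latticeVec ha hb hper hN x m
  refine ⟨f, fun k x y hx hy => havoid k x (mem_of_gridColoring_eq_some hx) y
    (mem_of_gridColoring_eq_some hy), ⟨latticeVec a b (1, 0), latticeVec a b (0, 1), ?_,
    fun x => ⟨hfper x _, hfper x _⟩, n + 1, n + 1, hN, hN, fun i j x hx y hy => ?_⟩,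
    _, hasDensity_of_periodic ha hb (measurableSet_removed_gridColoring U _ _) ?_, ?_⟩
  · rw [LinearIndependent.pair_iff]
    intro s t h
    have h0 := congrArg (fun x : Plane => x 0) h
    have h1 := congrArg (fun x : Plane => x 1) h
    simpa [ha.ne', hb.ne'] using And.intro h0 h1
  · exact gridColoring_congr U ((latticeIndex_eq_of_mem_parallelogramCell ha hb hN hx).trans
      (latticeIndex_eq_of_mem_parallelogramCell ha hb hN hy).symm)
  · intro m x
    change f _ = none ↔ f x = none
    rw [hfper]
  · have hsub : box a b ∩ f.removed ⊆ D n := by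
      rintro x ⟨hx, hr⟩
      refine ⟨hx, Set.mem_iInter.2 fun k => ?_⟩
      obtain ⟨y, hy, hyU⟩ := Set.not_subset.1 (someIndex_eq_none_iff.1 hr k)
      exact Metric.mem_thickening_iff.2 ⟨y, hyU,
        dist_lt_of_latticeIndex_eq (by positivity) (by positivity) (Eq.symm hy)⟩
    have h1 := ENNReal.toReal_mono ENNReal.ofReal_ne_top ((measure_mono hsub).trans hn.le)
    have hδ0 : 0 ≤ δ * (a * b) := by
      by_contra! h
      rw [ENNReal.ofReal_of_nonpos h.le] at hδ
      exact not_lt_zero hδ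
    rw [ENNReal.toReal_ofReal hδ0] at h1
    rw [Measure.real, Measure.real, volume_box ha.le, ENNReal.toReal_ofReal (by positivity),
      div_le_iff₀ (by positivity)]
    exact h1

/-! ### Tiles as stacks of trapezoids, and distances between them -/

/-- The cross section of a tile at one level: `(u, l, r)` stands for the segment `{u} × [l, r]`. -/
abbrev CrossSection : Type := ℤ × ℤ × ℤ

/-- The open trapezoid spanned by two cross sections. -/
def trapezoid (p q : CrossSection) : Set (ℝ × ℝ) :=
  {z | (p.1 < z.1 ∧ z.1 < q.1) ∧
    (q.1 - z.1) * p.2.1 + (z.1 - p.1) * q.2.1 < (q.1 - p.1) * z.2 ∧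
    (q.1 - p.1) * z.2 < (q.1 - z.1) * p.2.2 + (z.1 - p.1) * q.2.2}

/-- The pairs of consecutive cross sections. -/
def consecutive (T : List CrossSection) : List (CrossSection × CrossSection) := T.zip T.tail

/-- The union of the open trapezoids spanned by consecutive cross sections. -/
def tile (T : List CrossSection) : Set (ℝ × ℝ) :=
  {z | ∃ e ∈ consecutive T, z ∈ trapezoid e.1 e.2}

/-- The end points of the cross sections. -/
def vertices (T : List CrossSection) : List (ℤ × ℤ) :=
  T.flatMap fun p => [(p.1, p.2.1), (p.1, p.2.2)]

theorem isOpen_trapezoid (p q : CrossSection) : IsOpen (trapezoid p q) := by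
  refine .and (.and ?_ ?_) (.and ?_ ?_) <;> apply isOpen_lt <;> fun_prop

/-- For increasing levels the lines carrying the cross sections are left out of the tile. This costs
no area and makes the tile open. -/
theorem isOpen_tile (T : List CrossSection) : IsOpen (tile T) := by
  have : tile T = ⋃ e ∈ consecutive T, trapezoid e.1 e.2 := by ext; simp [tile]
  rw [this]
  exact isOpen_biUnion fun e _ => isOpen_trapezoid _ _

/-- A point of the trapezoid lies between the points at its level on the two slanted sides, and each
of these is a convex combination of two vertices. -/
theorem trapezoid_subset {K : Set (ℝ × ℝ)} (hK : Convex ℝ K) {p q : CrossSection}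
    (h : ∀ v ∈ vertices [p, q], ((v.1, v.2) : ℝ × ℝ) ∈ K) : trapezoid p q ⊆ K := by
  rintro ⟨x, y⟩ ⟨⟨h1, h2⟩, h3, h4⟩
  simp only at h1 h2 h3 h4
  simp only [vertices, List.flatMap_cons, List.flatMap_nil, List.append_nil, List.cons_append,
    List.nil_append, List.mem_cons, List.not_mem_nil, or_false, forall_eq_or_imp, forall_eq] at h
  obtain ⟨hpl, hpr, hql, hqr⟩ := h
  have hd : (0 : ℝ) < q.1 - p.1 := by linarith
  have comb (c d : ℝ) (hc : ((p.1 : ℝ), c) ∈ K) (hd' : ((q.1 : ℝ), d) ∈ K) :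
      (x, ((q.1 - x) * c + (x - p.1) * d) / (q.1 - p.1)) ∈ K := by
    have := hK hc hd' (a := (q.1 - x) / (q.1 - p.1)) (b := (x - p.1) / (q.1 - p.1))
      (div_nonneg (by linarith) hd.le) (div_nonneg (by linarith) hd.le) (by field_simp; ring)
    convert this using 1
    ext
    · simp; field_simp; ring
    · simp; field_simp
  have hl := comb _ _ hpl hql
  have hr := comb _ _ hpr hqr
  rw [mul_comm _ y, ← div_lt_iff₀ hd] at h3
  rw [mul_comm _ y, ← lt_div_iff₀ hd] at h4
  set c := ((q.1 - x) * p.2.1 + (x - p.1) * q.2.1) / ((q.1 : ℝ) - p.1)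
  set d := ((q.1 - x) * p.2.2 + (x - p.1) * q.2.2) / ((q.1 : ℝ) - p.1)
  have hcd : 0 < d - c := by linarith
  have := hK hl hr (a := (d - y) / (d - c)) (b := (y - c) / (d - c))
    (div_nonneg (by linarith) hcd.le) (div_nonneg (by linarith) hcd.le) (by field_simp; ring)
  convert this using 1
  ext
  · simp; field_simp; ring
  · simp; field_simp; ring

theorem mem_of_mem_consecutive {T : List CrossSection} {e : CrossSection × CrossSection}
    (he : e ∈ consecutive T) : e.1 ∈ T ∧ e.2 ∈ T :=
  ⟨(List.of_mem_zip he).1, List.mem_of_mem_tail (List.of_mem_zip he).2⟩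

theorem vertices_subset {T : List CrossSection} {e : CrossSection × CrossSection}
    (he : e ∈ consecutive T) : vertices [e.1, e.2] ⊆ vertices T := by
  intro v hv
  obtain ⟨p, hp, hv⟩ := List.mem_flatMap.1 hv
  refine List.mem_flatMap.2 ⟨p, ?_, hv⟩
  rcases List.mem_pair.1 hp with rfl | rfl
  exacts [(mem_of_mem_consecutive he).1, (mem_of_mem_consecutive he).2]

/-- The tile itself need not be convex: the argument runs trapezoid by trapezoid. This reduces
metric conditions on tiles to conditions on vertices. -/
theorem tile_subset {K : Set (ℝ × ℝ)} (hK : Convex ℝ K) {T : List CrossSection}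
    (h : ∀ v ∈ vertices T, ((v.1, v.2) : ℝ × ℝ) ∈ K) : tile T ⊆ K := by
  rintro z ⟨e, he, hz⟩
  exact trapezoid_subset hK (fun v hv => h v (vertices_subset he hv)) hz

theorem convex_disc (w : ℝ × ℝ) (e : ℝ) :
    Convex ℝ {z : ℝ × ℝ | (z.1 - w.1) ^ 2 + (z.2 - w.2) ^ 2 < e} := by
  have h : ConvexOn ℝ Set.univ fun z : ℝ × ℝ => (z.1 - w.1) ^ 2 + (z.2 - w.2) ^ 2 := by
    refine ⟨convex_univ, fun x _ y _ a b ha hb hab => ?_⟩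
    simp only [Prod.fst_add, Prod.smul_fst, smul_eq_mul, Prod.snd_add, Prod.smul_snd]
    obtain rfl : b = 1 - a := by linarith
    nlinarith [mul_nonneg (mul_nonneg ha hb) (sq_nonneg (x.1 - y.1)),
      mul_nonneg (mul_nonneg ha hb) (sq_nonneg (x.2 - y.2))]
  simpa using h.convex_lt e

theorem convex_halfPlane (p q e : ℝ) : Convex ℝ {z : ℝ × ℝ | p * z.1 + q * z.2 < e} :=
  convex_halfSpace_lt (f := fun z : ℝ × ℝ => p * z.1 + q * z.2)
    ⟨fun _ _ => by simp; ring, fun _ _ => by simp; ring⟩ e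

theorem convex_halfPlane_le (p q e : ℝ) : Convex ℝ {z : ℝ × ℝ | e ≤ p * z.1 + q * z.2} :=
  convex_halfSpace_ge (f := fun z : ℝ × ℝ => p * z.1 + q * z.2)
    ⟨fun _ _ => by simp; ring, fun _ _ => by simp; ring⟩ e

/-- The diameter of a tile is attained at its vertices. -/
theorem sq_dist_lt_of_mem_tile {T : List CrossSection} {S : ℤ}
    (h : ∀ u ∈ vertices T, ∀ v ∈ vertices T, (u.1 - v.1) ^ 2 + (u.2 - v.2) ^ 2 < S ^ 2)
    {z w : ℝ × ℝ} (hz : z ∈ tile T) (hw : w ∈ tile T) :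
    (z.1 - w.1) ^ 2 + (z.2 - w.2) ^ 2 < (S : ℝ) ^ 2 := by
  -- Convexity of discs is used twice: about `w` to replace `z` by a vertex `u`, then about `u` to
  -- replace `w` by a vertex.
  refine tile_subset (convex_disc w _) (fun u hu => ?_) hz
  have : w ∈ {w : ℝ × ℝ | (w.1 - u.1) ^ 2 + (w.2 - u.2) ^ 2 < (S : ℝ) ^ 2} :=
    tile_subset (convex_disc (u.1, u.2) _) (fun v hv => by
      have := h v hv u hu
      simp only [Set.mem_ofPred_eq]
      exact_mod_cast this) hw
  simp only [Set.mem_ofPred_eq] at this ⊢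
  convert this using 1
  ring

/-- The points of `tile T` and of the translate of `tile T'` by `d` have distance more than `S`. -/
def IsFar (S : ℤ) (T T' : List CrossSection) (d : ℤ × ℤ) : Prop :=
  ∀ z ∈ tile T, ∀ w ∈ tile T', (S : ℝ) ^ 2 < (w.1 + d.1 - z.1) ^ 2 + (w.2 + d.2 - z.2) ^ 2

theorem IsFar.symm {S : ℤ} {T T' : List CrossSection} {d : ℤ × ℤ} (h : IsFar S T T' d) :
    IsFar S T' T (-d) := by
  intro z hz w hw
  have := h w hw z hz
  simp only [Prod.fst_neg, Prod.snd_neg, Int.cast_neg]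
  convert this using 1
  ring

/-- Each trapezoid of `T` is separated from all of the translate of `T'` by a strip of width more
than `S` that is bounded by one of the lines `g.1 * x + g.2.1 * y = g.2.2` with `g ∈ gs`. -/
def SeparatedBy (S : ℤ) (T T' : List CrossSection) (d : ℤ × ℤ) (gs : List (ℤ × ℤ × ℤ)) : Prop :=
  (∀ g ∈ gs, ∀ v ∈ vertices T', g.2.2 ≤ g.1 * (v.1 + d.1) + g.2.1 * (v.2 + d.2)) ∧
  ∀ e ∈ consecutive T, ∃ g ∈ gs, ∀ v ∈ vertices [e.1, e.2],
    g.1 * v.1 + g.2.1 * v.2 < g.2.2 ∧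
      (g.1 ^ 2 + g.2.1 ^ 2) * S ^ 2 < (g.2.2 - (g.1 * v.1 + g.2.1 * v.2)) ^ 2

instance (S : ℤ) (T T' : List CrossSection) (d : ℤ × ℤ) (gs : List (ℤ × ℤ × ℤ)) :
    Decidable (SeparatedBy S T T' d gs) := by
  unfold SeparatedBy; infer_instance

/-- The linear form with normal `(p, q)` is at least `c` on the translated tile and less than `c - S
* √(p² + q²)` on the trapezoid. Cauchy–Schwarz turns this gap into a Euclidean distance. Different
trapezoids of `T` may use different lines. -/
theorem SeparatedBy.isFar {S : ℤ} {T T' : List CrossSection} {d : ℤ × ℤ}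
    {gs : List (ℤ × ℤ × ℤ)} (h : SeparatedBy S T T' d gs) : IsFar S T T' d := by
  rintro z ⟨e, he, hz⟩ w hw
  obtain ⟨g, hg, hv⟩ := h.2 e he
  obtain ⟨p, q, c⟩ := g
  simp only at hv
  have h1 : (c : ℝ) - p * d.1 - q * d.2 ≤ p * w.1 + q * w.2 := by
    refine tile_subset (convex_halfPlane_le p q _) (fun v hv => ?_) hw
    have : (c : ℝ) ≤ p * (v.1 + d.1) + q * (v.2 + d.2) := by exact_mod_cast h.1 _ hg v hv
    simp only [Set.mem_ofPred_eq]
    linarith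
  have h2 : p * z.1 + q * z.2 < c - √(((p : ℝ) ^ 2 + q ^ 2) * S ^ 2) := by
    refine trapezoid_subset (convex_halfPlane p q _) (fun v hv' => ?_) hz
    obtain ⟨h3, h4⟩ := hv v hv'
    have h3' : (p : ℝ) * v.1 + q * v.2 < c := by exact_mod_cast h3
    have h4' : ((p : ℝ) ^ 2 + q ^ 2) * S ^ 2 < (c - (p * v.1 + q * v.2)) ^ 2 := by
      exact_mod_cast h4
    have := (Real.sqrt_lt' (sub_pos.2 h3')).2 h4'
    simp only [Set.mem_ofPred_eq]
    linarith
  have h5 := Real.sqrt_nonneg (((p : ℝ) ^ 2 + q ^ 2) * S ^ 2)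
  have h6 : ((p : ℝ) ^ 2 + q ^ 2) * S ^ 2 <
      (p * (w.1 + d.1 - z.1) + q * (w.2 + d.2 - z.2)) ^ 2 := by
    rw [← Real.sqrt_lt' (by linarith)]
    linarith
  have h7 : (p * (w.1 + d.1 - z.1) + q * (w.2 + d.2 - z.2)) ^ 2 ≤
      ((p : ℝ) ^ 2 + q ^ 2) * ((w.1 + d.1 - z.1) ^ 2 + (w.2 + d.2 - z.2) ^ 2) := by
    nlinarith [sq_nonneg (p * (w.2 + d.2 - z.2) - q * (w.1 + d.1 - z.1))]
  exact lt_of_mul_lt_mul_left (h6.trans_le h7) (by positivity)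

/-! ### Disjointness and area of trapezoids and tiles -/

/-- The translate of the second trapezoid by `d` lies above or below the first, or the two have the
same levels and lie side by side. -/
def AreApart (e f : CrossSection × CrossSection) (d : ℤ × ℤ) : Prop :=
  e.2.1 ≤ f.1.1 + d.1 ∨ f.2.1 + d.1 ≤ e.1.1 ∨
    (e.1.1 = f.1.1 + d.1 ∧ e.2.1 = f.2.1 + d.1) ∧
      ((e.1.2.2 ≤ f.1.2.1 + d.2 ∧ e.2.2.2 ≤ f.2.2.1 + d.2) ∨
        (f.1.2.2 + d.2 ≤ e.1.2.1 ∧ f.2.2.2 + d.2 ≤ e.2.2.1))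

instance (e f : CrossSection × CrossSection) (d : ℤ × ℤ) : Decidable (AreApart e f d) := by
  unfold AreApart; infer_instance

theorem AreApart.add_notMem {e f : CrossSection × CrossSection} {d : ℤ × ℤ}
    (h : AreApart e f d) {w : ℝ × ℝ} (hw : w ∈ trapezoid f.1 f.2) :
    (w.1 + d.1, w.2 + d.2) ∉ trapezoid e.1 e.2 := by
  obtain ⟨⟨p, pl, pr⟩, q, ql, qr⟩ := e
  obtain ⟨⟨p', pl', pr'⟩, q', ql', qr'⟩ := f
  obtain ⟨x, y⟩ := w
  rintro ⟨⟨h1, h2⟩, h3, h4⟩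
  obtain ⟨⟨h5, h6⟩, h7, h8⟩ := hw
  simp only [AreApart] at *
  rcases h with h | h | ⟨⟨rfl, rfl⟩, ⟨ha, hb⟩ | ⟨ha, hb⟩⟩
  · have : (q : ℝ) ≤ p' + d.1 := by exact_mod_cast h
    linarith
  · have : (q' : ℝ) + d.1 ≤ p := by exact_mod_cast h
    linarith
  · have ha' : (pr : ℝ) ≤ pl' + d.2 := by exact_mod_cast ha
    have hb' : (qr : ℝ) ≤ ql' + d.2 := by exact_mod_cast hb
    push_cast at *
    have := mul_le_mul_of_nonneg_left ha' (sub_nonneg.2 h6.le)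
    have := mul_le_mul_of_nonneg_left hb' (sub_nonneg.2 h5.le)
    linarith
  · have ha' : (pr' : ℝ) + d.2 ≤ pl := by exact_mod_cast ha
    have hb' : (qr' : ℝ) + d.2 ≤ ql := by exact_mod_cast hb
    push_cast at *
    have := mul_le_mul_of_nonneg_left ha' (sub_nonneg.2 h6.le)
    have := mul_le_mul_of_nonneg_left hb' (sub_nonneg.2 h5.le)
    linarith

theorem volume_trapezoid {p q : CrossSection} (h : p.1 < q.1) (hp : p.2.1 ≤ p.2.2)
    (hq : q.2.1 ≤ q.2.2) :
    volume (trapezoid p q) =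
      ENNReal.ofReal (((q.1 - p.1) * (p.2.2 - p.2.1 + (q.2.2 - q.2.1)) : ℤ) / 2) := by
  obtain ⟨p, pl, pr⟩ := p
  obtain ⟨q, ql, qr⟩ := q
  simp only at h hp hq ⊢
  have hd : (0 : ℝ) < q - p := sub_pos.2 (by exact_mod_cast h)
  have hp' : (pl : ℝ) ≤ pr := by exact_mod_cast hp
  have hq' : (ql : ℝ) ≤ qr := by exact_mod_cast hq
  have hreg : trapezoid (p, pl, pr) (q, ql, qr) =
      regionBetween (fun x => (((q : ℝ) - x) * pl + (x - p) * ql) / (q - p))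
        (fun x => (((q : ℝ) - x) * pr + (x - p) * qr) / (q - p)) (Set.Ioo p q) := by
    ext ⟨x, y⟩
    simp only [trapezoid, regionBetween, Set.mem_ofPred_eq, Set.mem_Ioo, div_lt_iff₀ hd,
      lt_div_iff₀ hd, mul_comm y]
  rw [hreg, Measure.volume_eq_prod, volume_regionBetween_eq_integral]
  · congr 1
    rw [← integral_Ioc_eq_integral_Ioo, ← intervalIntegral.integral_of_le (by linarith)]
    -- The width at level `x` interpolates linearly between `pr - pl` and `qr - ql`; its
    -- antiderivative is written in squares of `x - p` and `q - x`.
    have : ∀ x ∈ Set.uIcc (p : ℝ) q, HasDerivAt (fun x : ℝ =>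
        ((x - p) ^ 2 * (qr - ql) - (q - x) ^ 2 * (pr - pl)) / (2 * (q - p)))
        (((fun x => (((q : ℝ) - x) * pr + (x - p) * qr) / (q - p)) -
          (fun x => (((q : ℝ) - x) * pl + (x - p) * ql) / (q - p))) x) x := by
      intro x _
      have h1 : HasDerivAt (fun x : ℝ => (x - p) ^ 2) (2 * (x - p)) x := by
        simpa using ((hasDerivAt_id x).sub_const (p : ℝ)).fun_pow 2
      have h2 : HasDerivAt (fun x : ℝ => (q - x) ^ 2) (-(2 * (q - x))) x := by
        simpa using ((hasDerivAt_id x).const_sub (q : ℝ)).fun_pow 2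
      refine (((h1.mul_const ((qr : ℝ) - ql)).sub (h2.mul_const ((pr : ℝ) - pl))).div_const
        (2 * ((q : ℝ) - p))).congr_deriv ?_
      rw [Pi.sub_apply]
      field_simp
      ring
    rw [intervalIntegral.integral_eq_sub_of_hasDerivAt this
      (Continuous.intervalIntegrable (by fun_prop) _ _)]
    push_cast
    field_simp
    ring
  · exact (Continuous.integrableOn_Icc (by fun_prop)).mono_set Set.Ioo_subset_Icc_self
  · exact (Continuous.integrableOn_Icc (by fun_prop)).mono_set Set.Ioo_subset_Icc_self
  · exact measurableSet_Ioo
  · rintro x ⟨h1, h2⟩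
    have := mul_le_mul_of_nonneg_left hp' (sub_nonneg.2 h2.le)
    have := mul_le_mul_of_nonneg_left hq' (sub_nonneg.2 h1.le)
    gcongr ?_ / _
    linarith

/-- Twice the area of a tile. -/
def doubleArea (T : List CrossSection) : ℤ :=
  ((consecutive T).map fun e =>
    (e.2.1 - e.1.1) * (e.1.2.2 - e.1.2.1 + (e.2.2.2 - e.2.2.1))).sum

/-- The levels of the cross sections increase. -/
def IsStacked (T : List CrossSection) : Prop :=
  (∀ p ∈ T, p.2.1 ≤ p.2.2) ∧ T.IsChain fun p q => p.1 < q.1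

instance (T : List CrossSection) : Decidable (IsStacked T) := by
  unfold IsStacked; infer_instance

/-- Increasing levels make the trapezoids disjoint, so areas add. Nonnegativity is carried along
because `ENNReal.ofReal` is additive only on nonnegative numbers. -/
theorem volume_tile {T : List CrossSection} (h : IsStacked T) :
    0 ≤ doubleArea T ∧ volume (tile T) = ENNReal.ofReal (doubleArea T / 2) := by
  obtain ⟨hle, hch⟩ := h
  induction T with
  | nil => simp [doubleArea, tile, consecutive]
  | cons p T ih =>
    cases T with
    | nil => simp [doubleArea, tile, consecutive]
    | cons q T =>
      rw [List.isChain_cons_cons] at hch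
      obtain ⟨h0, ih⟩ := ih (fun x hx => hle x (List.mem_cons_of_mem _ hx)) hch.2
      have hp := hle p (by simp)
      have hq := hle q (by simp)
      have hcons : tile (p :: q :: T) = trapezoid p q ∪ tile (q :: T) := by
        ext z; simp [tile, consecutive]
      have harea : doubleArea (p :: q :: T) =
          (q.1 - p.1) * (p.2.2 - p.2.1 + (q.2.2 - q.2.1)) + doubleArea (q :: T) := by
        simp [doubleArea, consecutive]
      have hpos : 0 ≤ (q.1 - p.1) * (p.2.2 - p.2.1 + (q.2.2 - q.2.1)) :=
        mul_nonneg (by linarith) (by linarith)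
      have habove (z : ℝ × ℝ) (hz : z ∈ tile (q :: T)) : (q.1 : ℝ) ≤ z.1 := by
        obtain ⟨e, he, hz⟩ := hz
        refine le_trans ?_ hz.1.1.le
        have := (mem_of_mem_consecutive he).1
        rcases List.mem_cons.1 this with h | h
        · rw [h]
        · have hpw := List.isChain_iff_pairwise (R := fun p q : CrossSection => p.1 < q.1)
            |>.1 hch.2
          exact_mod_cast (List.rel_of_pairwise_cons hpw h).le
      rw [hcons, harea, measure_union _ (isOpen_tile _).measurableSet, ih,
        volume_trapezoid hch.1 hp hq, ← ENNReal.ofReal_add]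
      · refine ⟨add_nonneg hpos h0, ?_⟩
        push_cast
        ring_nf
      · have : (0 : ℝ) ≤ ((q.1 - p.1) * (p.2.2 - p.2.1 + (q.2.2 - q.2.1)) : ℤ) := by
          exact_mod_cast hpos
        positivity
      · have : (0 : ℝ) ≤ doubleArea (q :: T) := by exact_mod_cast h0
        positivity
      · exact Set.disjoint_left.2 fun z hz hz' => (habove z hz').not_gt hz.1.2

/-! ### Periodic arrangements and the colorings they define -/

/-- If the lattice translates of finitely many sets are pairwise disjoint, then together they cover
the sum of the areas of these sets in the fundamental rectangle. -/
theorem volume_box_inter_translates {ι : Type*} [Fintype ι] {a b : ℝ} (ha : 0 < a) (hb : 0 < b)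
    {P : ι → Set Plane} (hP : ∀ i, MeasurableSet (P i))
    (hdisj : ∀ i j n, ∀ x ∈ P i, x + latticeVec a b n ∈ P j → i = j ∧ n = 0) :
    volume (box a b ∩ {x | ∃ i n, x + latticeVec a b n ∈ P i}) = ∑ i, volume (P i) := by
  have hadd (m n : ℤ × ℤ) : latticeVec a b m + latticeVec a b n = latticeVec a b (m + n) :=
    plane_ext (by simp; ring) (by simp; ring)
  have hu : box a b ∩ {x | ∃ i n, x + latticeVec a b n ∈ P i} =
      ⋃ p : ι × ℤ × ℤ, {x | x ∈ box a b ∧ x + latticeVec a b p.2 ∈ P p.1} := by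
    ext x; simp
  have hm (p : ι × ℤ × ℤ) :
      MeasurableSet {x | x ∈ box a b ∧ x + latticeVec a b p.2 ∈ P p.1} :=
    (measurableSet_box a b).inter ((measurable_id.add_const _) (hP p.1))
  rw [hu, measure_iUnion _ hm, ENNReal.tsum_prod
    (f := fun i n => volume {x | x ∈ box a b ∧ x + latticeVec a b n ∈ P i}), tsum_fintype]
  · exact Finset.sum_congr rfl fun i _ => (volume_eq_tsum_box ha hb (hP i)).symm
  · rintro ⟨i, m⟩ ⟨j, n⟩ hne
    refine Set.disjoint_left.2 fun x hx hy => hne ?_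
    have := hdisj i j (n - m) _ hx.2 (by
      rw [add_assoc, hadd, add_sub_cancel]; exact hy.2)
    rw [Prod.mk.injEq]
    exact ⟨this.1, (sub_eq_zero.1 this.2).symm⟩

/-- The points of the plane whose multiples by `S` lie in a tile. -/
def scaledTile (S : ℤ) (T : List CrossSection) : Set Plane :=
  {x | (S * x 0, S * x 1) ∈ tile T}

theorem isOpen_scaledTile (S : ℤ) (T : List CrossSection) : IsOpen (scaledTile S T) :=
  (isOpen_tile T).preimage (f := fun x : Plane => ((S : ℝ) * x 0, (S : ℝ) * x 1)) (by fun_prop)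

theorem volume_scaledTile {S : ℤ} (hS : 0 < S) {T : List CrossSection} (h : IsStacked T) :
    volume (scaledTile S T) = ENNReal.ofReal (doubleArea T / (2 * S ^ 2)) := by
  have hS' : (0 : ℝ) < S := by exact_mod_cast hS
  have hpre : scaledTile S T = planeEquiv ⁻¹' ((fun z : ℝ × ℝ => (S : ℝ) • z) ⁻¹' tile T) := by
    ext x; simp [scaledTile]
  rw [hpre, measurePreserving_planeEquiv.measure_preimage_equiv,
    Measure.addHaar_preimage_smul _ hS'.ne', (volume_tile h).2, ← ENNReal.ofReal_mul (abs_nonneg _)]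
  congr 1
  rw [Module.finrank_prod, Module.finrank_self, abs_of_pos (by positivity)]
  field_simp
  ring

/-- A periodic arrangement of colored tiles with integral coordinates, in which tiles of the same
color avoid the distance `S` and the translates of all tiles are disjoint. -/
structure Arrangement (ι κ : Type*) where
  /-- The unit of length. -/
  S : ℤ
  /-- The first period. -/
  A : ℤ
  /-- The second period. -/
  B : ℤ
  S_pos : 0 < S
  A_pos : 0 < A
  B_pos : 0 < B
  /-- The cross sections of the tiles. -/
  T : ι → List CrossSection
  /-- The colors of the tiles. -/
  color : ι → κ
  stacked : ∀ i, IsStacked (T i)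
  near : ∀ i, ∀ u ∈ vertices (T i), ∀ v ∈ vertices (T i),
    (u.1 - v.1) ^ 2 + (u.2 - v.2) ^ 2 < S ^ 2
  far : ∀ i j, color i = color j → ∀ n : ℤ × ℤ, ¬ (i = j ∧ n = 0) →
    IsFar S (T i) (T j) (n.1 * A, n.2 * B)
  apart : ∀ i j, color i ≠ color j → ∀ n : ℤ × ℤ, ∀ e ∈ consecutive (T i),
    ∀ f ∈ consecutive (T j), ∀ w ∈ trapezoid f.1 f.2,
      (w.1 + (n.1 * A : ℤ), w.2 + (n.2 * B : ℤ)) ∉ trapezoid e.1 e.2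

namespace Arrangement

variable {ι κ : Type*} (D : Arrangement ι κ)

/-- The points with color `k`. -/
def colorClass (k : κ) : Set Plane :=
  {x | ∃ i n, D.color i = k ∧ x + latticeVec (D.A / D.S) (D.B / D.S) n ∈ scaledTile D.S (D.T i)}

theorem S_real_pos : (0 : ℝ) < D.S := by exact_mod_cast D.S_pos

theorem isOpen_colorClass (k : κ) : IsOpen (D.colorClass k) := by
  have : D.colorClass k = ⋃ i, ⋃ n, ⋃ _ : D.color i = k,
      (fun x => x + latticeVec (D.A / D.S) (D.B / D.S) n) ⁻¹' scaledTile D.S (D.T i) := by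
    ext x; simp [colorClass]
  rw [this]
  exact isOpen_iUnion fun i => isOpen_iUnion fun n => isOpen_iUnion fun _ =>
    (isOpen_scaledTile _ _).preimage (by fun_prop)

theorem add_mem_colorClass_iff (k : κ) (n : ℤ × ℤ) (x : Plane) :
    x + latticeVec (D.A / D.S) (D.B / D.S) n ∈ D.colorClass k ↔ x ∈ D.colorClass k := by
  have hadd (m : ℤ × ℤ) : x + latticeVec (D.A / D.S) (D.B / D.S) n +
      latticeVec (D.A / D.S) (D.B / D.S) m = x + latticeVec (D.A / D.S) (D.B / D.S) (n + m) :=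
    plane_ext (by simp; ring) (by simp; ring)
  constructor
  · rintro ⟨i, m, hi, hx⟩
    exact ⟨i, n + m, hi, by rwa [← hadd]⟩
  · rintro ⟨i, m, hi, hx⟩
    exact ⟨i, m - n, hi, by rwa [hadd, add_sub_cancel]⟩

theorem scaled_add_latticeVec (x : Plane) (n : ℤ × ℤ) :
    (D.S * (x + latticeVec (D.A / D.S) (D.B / D.S) n) 0 = D.S * x 0 + n.1 * D.A) ∧
      D.S * (x + latticeVec (D.A / D.S) (D.B / D.S) n) 1 = D.S * x 1 + n.2 * D.B := by
  have := D.S_real_pos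
  constructor <;> simp <;> field_simp

/-- Two points in the same translate of the same tile are closer than 1 by `near`; in all other
cases `far` puts them more than 1 apart. Only the relative translation `m - n` matters. -/
theorem dist_ne_one (k : κ) {x y : Plane} (hx : x ∈ D.colorClass k) (hy : y ∈ D.colorClass k) :
    dist x y ≠ 1 := by
  obtain ⟨i, m, hi, hx⟩ := hx
  obtain ⟨j, n, hj, hy⟩ := hy
  have hS := D.S_real_pos
  intro h
  have hsq : (D.S * x 0 - D.S * y 0) ^ 2 + (D.S * x 1 - D.S * y 1) ^ 2 = (D.S : ℝ) ^ 2 := by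
    rw [EuclideanSpace.dist_eq, Real.sqrt_eq_one, Fin.sum_univ_two, Real.dist_eq, Real.dist_eq,
      sq_abs, sq_abs] at h
    linear_combination (D.S : ℝ) ^ 2 * h
  simp only [scaledTile, Set.mem_ofPred_eq, D.scaled_add_latticeVec] at hx hy
  by_cases hij : i = j ∧ m - n = 0
  · obtain ⟨rfl, hmn⟩ := hij
    rw [sub_eq_zero] at hmn
    subst hmn
    have := sq_dist_lt_of_mem_tile (D.near i) hx hy
    simp only [add_sub_add_right_eq_sub] at this
    linarith
  · have := D.far i j (hi.trans hj.symm) (m - n) hij _ hx _ hy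
    simp only [Prod.fst_sub, Prod.snd_sub, Int.cast_mul, Int.cast_sub] at this
    refine this.ne ?_
    rw [← hsq]
    ring

/-- For equal colors a common point would be at distance 0 from itself, against `far`; for different
colors this is `apart`. -/
theorem eq_of_add_mem (i j : ι) (n : ℤ × ℤ) (x : Plane) (hx : x ∈ scaledTile D.S (D.T i))
    (hy : x + latticeVec (D.A / D.S) (D.B / D.S) n ∈ scaledTile D.S (D.T j)) :
    i = j ∧ n = 0 := by
  have hS := D.S_real_pos
  simp only [scaledTile, Set.mem_ofPred_eq, D.scaled_add_latticeVec] at hx hy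
  by_cases hc : D.color i = D.color j
  · by_contra hij
    have := D.far i j hc (-n) (by simpa using hij) _ hx _ hy
    simp only [Prod.fst_neg, Prod.snd_neg, Int.cast_mul, Int.cast_neg] at this
    ring_nf at this
    nlinarith
  · obtain ⟨e, he, hx⟩ := hx
    obtain ⟨f, hf, hy⟩ := hy
    refine absurd ?_ (D.apart i j hc (-n) e he f hf _ hy)
    convert hx using 2 <;> simp

/-- The hypothesis, divided by `2 * S ^ 2`, says that the tiles cover more than the fraction `1 - δ`
of a fundamental rectangle. Strictness leaves room for the passage to grid cells. -/
theorem exists_coloring [Fintype ι] {c : ℕ} (D : Arrangement ι (Fin c)) {δ : ℝ}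
    (hδ : 2 * (1 - δ) * (D.A * D.B) < (∑ i, doubleArea (D.T i) : ℤ)) :
    ∃ f : PartialColoring c, f.AvoidsUnitDistance ∧
      (∃ v w : Plane, LinearIndependent ℝ ![v, w] ∧ f.IsPeriodic v w ∧
        ∃ k l : ℕ, 0 < k ∧ 0 < l ∧ f.IsConstantOnCells v w k l) ∧
      ∃ d : ℝ, HasDensity f.removed d ∧ d ≤ δ := by
  have hS := D.S_real_pos
  have hA : (0 : ℝ) < D.A := by exact_mod_cast D.A_pos
  have hB : (0 : ℝ) < D.B := by exact_mod_cast D.B_pos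
  have hm (i : ι) : MeasurableSet (scaledTile D.S (D.T i)) :=
    (isOpen_scaledTile _ _).measurableSet
  refine exists_cell_coloring (a := D.A / D.S) (b := D.B / D.S) (by positivity) (by positivity)
    D.isOpen_colorClass D.add_mem_colorClass_iff (fun k x hx y hy => D.dist_ne_one k hx hy) ?_
  have hU : (⋃ k, D.colorClass k) =
      {x | ∃ i n, x + latticeVec (D.A / D.S) (D.B / D.S) n ∈ scaledTile D.S (D.T i)} := by
    ext x; simp [colorClass]
  have harea := volume_box_inter_translates (a := D.A / D.S) (b := D.B / D.S) (by positivity)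
    (by positivity) hm D.eq_of_add_mem
  have hnonneg (i : ι) : (0 : ℝ) ≤ doubleArea (D.T i) / (2 * (D.S : ℝ) ^ 2) := by
    have : (0 : ℝ) ≤ doubleArea (D.T i) := by exact_mod_cast (volume_tile (D.stacked i)).1
    positivity
  rw [Finset.sum_congr rfl fun i _ => volume_scaledTile D.S_pos (D.stacked i),
    ← ENNReal.ofReal_sum_of_nonneg fun i _ => ?_, ← hU] at harea
  · have hfin : volume (box ((D.A : ℝ) / D.S) (D.B / D.S)) ≠ ⊤ := by
      rw [volume_box (by positivity)]; exact ENNReal.ofReal_ne_top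
    have hle := harea ▸ measure_mono (μ := volume) (Set.inter_subset_left
      (s := box ((D.A : ℝ) / D.S) (D.B / D.S)) (t := ⋃ k, D.colorClass k))
    rw [volume_box (by positivity), ENNReal.ofReal_le_ofReal_iff (by positivity)] at hle
    rw [← Set.sdiff_eq, ← Set.sdiff_self_inter, measure_sdiff Set.inter_subset_left
      ((measurableSet_box _ _).inter
        (isOpen_iUnion D.isOpen_colorClass).measurableSet).nullMeasurableSet
      (measure_ne_top_of_subset Set.inter_subset_left hfin), harea, volume_box (by positivity),
      ← ENNReal.ofReal_sub _ (Finset.sum_nonneg fun i _ => hnonneg i),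
      ENNReal.ofReal_lt_ofReal_iff_of_nonneg (sub_nonneg.2 hle)]
    rw [← Finset.sum_div, sub_lt_comm, lt_div_iff₀ (by positivity)]
    push_cast at hδ
    refine lt_of_eq_of_lt ?_ hδ
    field_simp
  · exact hnonneg i

end Arrangement

/-! ### Reduction to finitely many integer inequalities -/

/-- The box `[b.1.1, b.1.2] × [b.2.1, b.2.2]` contains the vertices of `T`. -/
def InBox (T : List CrossSection) (b : (ℤ × ℤ) × ℤ × ℤ) : Prop :=
  ∀ v ∈ vertices T, (b.1.1 ≤ v.1 ∧ v.1 ≤ b.1.2) ∧ b.2.1 ≤ v.2 ∧ v.2 ≤ b.2.2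

instance (T : List CrossSection) (b : (ℤ × ℤ) × ℤ × ℤ) : Decidable (InBox T b) := by
  unfold InBox; infer_instance

/-- In one of the coordinates the box `b`, translated by `d`, is more than `s` away from `a`. -/
def BoxesApart (s : ℤ) (a b : (ℤ × ℤ) × ℤ × ℤ) (d : ℤ × ℤ) : Prop :=
  (a.1.2 + s < b.1.1 + d.1 ∨ b.1.2 + d.1 + s < a.1.1) ∨
    a.2.2 + s < b.2.1 + d.2 ∨ b.2.2 + d.2 + s < a.2.1

instance (s : ℤ) (a b : (ℤ × ℤ) × ℤ × ℤ) (d : ℤ × ℤ) : Decidable (BoxesApart s a b d) := by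
  unfold BoxesApart; infer_instance

/-- A gap in one coordinate already bounds the distance. It serves with `s = S` for tiles of one
color and with `s = 0` for mere disjointness. -/
theorem BoxesApart.isFar {s : ℤ} (hs : 0 ≤ s) {a b : (ℤ × ℤ) × ℤ × ℤ} {d : ℤ × ℤ}
    (h : BoxesApart s a b d) {T T' : List CrossSection} (hT : InBox T a) (hT' : InBox T' b) :
    IsFar s T T' d := by
  have bounds {T : List CrossSection} {a : (ℤ × ℤ) × ℤ × ℤ} (hT : InBox T a) :
      tile T ⊆ Set.Icc (a.1.1 : ℝ) a.1.2 ×ˢ Set.Icc (a.2.1 : ℝ) a.2.2 := by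
    refine tile_subset ((convex_Icc _ _).prod (convex_Icc _ _)) fun v hv => ?_
    obtain ⟨⟨h1, h2⟩, h3, h4⟩ := hT v hv
    exact ⟨⟨Int.cast_le.2 h1, Int.cast_le.2 h2⟩, Int.cast_le.2 h3, Int.cast_le.2 h4⟩
  have key {p q : ℤ × ℤ} {t : ℤ} {x y : ℝ} (hx : x ∈ Set.Icc (p.1 : ℝ) p.2)
      (hy : y ∈ Set.Icc (q.1 : ℝ) q.2) (h : p.2 + s < q.1 + t ∨ q.2 + t + s < p.1) :
      (s : ℝ) ^ 2 < (y + t - x) ^ 2 := by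
    have hs' : (0 : ℝ) ≤ s := Int.cast_nonneg hs
    rw [sq_lt_sq, abs_of_nonneg hs', lt_abs]
    rcases h with h | h
    · have h' : (p.2 : ℝ) + s < q.1 + t := by exact_mod_cast h
      left
      linarith [hx.2, hy.1]
    · have h' : (q.2 : ℝ) + t + s < p.1 := by exact_mod_cast h
      right
      linarith [hx.1, hy.2]
  intro z hz w hw
  obtain ⟨hz1, hz2⟩ := bounds hT hz
  obtain ⟨hw1, hw2⟩ := bounds hT' hw
  rcases h with h | h
  · nlinarith [key hz1 hw1 h, sq_nonneg (w.2 + d.2 - z.2)]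
  · nlinarith [key hz2 hw2 h, sq_nonneg (w.1 + d.1 - z.1)]

/-- A shift by two or more periods in some direction exceeds the extent of all boxes plus `s`, so
only nine translations need inspection. -/
theorem boxesApart_of_notMem {s A B x y : ℤ} (hA : 0 < A) (hB : 0 < B) (hx : x + s < 2 * A)
    (hy : y + s < 2 * B) {a b : (ℤ × ℤ) × ℤ × ℤ}
    (ha : (0 ≤ a.1.1 ∧ a.1.2 ≤ x) ∧ 0 ≤ a.2.1 ∧ a.2.2 ≤ y)
    (hb : (0 ≤ b.1.1 ∧ b.1.2 ≤ x) ∧ 0 ≤ b.2.1 ∧ b.2.2 ≤ y) {n₁ n₂ : ℤ}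
    (hn : ¬ (n₁ ∈ Finset.Icc (-1) 1 ∧ n₂ ∈ Finset.Icc (-1) 1)) :
    BoxesApart s a b (n₁ * A, n₂ * B) := by
  have key {m t : ℤ} (ht : 0 < t) (hm : ¬ m ∈ Finset.Icc (-1) 1) :
      2 * t ≤ m * t ∨ m * t ≤ (-2) * t := by
    rw [Finset.mem_Icc] at hm
    rcases le_or_gt 2 m with h | h
    · exact .inl (mul_le_mul_of_nonneg_right h ht.le)
    · exact .inr (mul_le_mul_of_nonneg_right (by lia) ht.le)
  simp only [BoxesApart]
  rw [not_and_or] at hn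
  rcases hn with hn | hn
  · have := key hA hn
    lia
  · have := key hB hn
    lia

/-- It suffices to bound the distances of opposite end points of the cross sections. -/
theorem sq_add_sq_lt_of_opposite {T : List CrossSection} {s : ℤ} (hT : IsStacked T)
    (h : ∀ p ∈ T, ∀ q ∈ T, (p.1 - q.1) ^ 2 + (p.2.2 - q.2.1) ^ 2 < s) :
    ∀ u ∈ vertices T, ∀ v ∈ vertices T, (u.1 - v.1) ^ 2 + (u.2 - v.2) ^ 2 < s := by
  have hmem {u : ℤ × ℤ} (hu : u ∈ vertices T) : ∃ p ∈ T, p.1 = u.1 ∧ p.2.1 ≤ u.2 ∧ u.2 ≤ p.2.2 := by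
    obtain ⟨p, hp, hu⟩ := List.mem_flatMap.1 hu
    have := hT.1 p hp
    rcases List.mem_pair.1 hu with rfl | rfl
    · exact ⟨p, hp, rfl, le_rfl, this⟩
    · exact ⟨p, hp, rfl, this, le_rfl⟩
  intro u hu v hv
  obtain ⟨p, hp, hp1, hp2, hp3⟩ := hmem hu
  obtain ⟨q, hq, hq1, hq2, hq3⟩ := hmem hv
  have h1 := h p hp q hq
  have h2 := h q hq p hp
  rw [hp1, hq1] at h1 h2
  -- The larger second coordinate is at most the right end of its section, the smaller at least the
  -- left end of its own.
  rcases le_total v.2 u.2 with h3 | h3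
  · nlinarith
  · nlinarith

theorem IsFar.add_notMem {S : ℤ} {T T' : List CrossSection} {d : ℤ × ℤ} (h : IsFar S T T' d)
    {w : ℝ × ℝ} (hw : w ∈ tile T') : (w.1 + d.1, w.2 + d.2) ∉ tile T := by
  intro hz
  have := h _ hz w hw
  simp only [sub_self] at this
  nlinarith [sq_nonneg (S : ℝ)]

/-- An arrangement of tiles from a finite list of conditions on integers. -/
def Arrangement.ofList {m c : ℕ} (S A B x y : ℤ) (T : Fin m → List CrossSection)
    (box : Fin m → (ℤ × ℤ) × ℤ × ℤ) (color : Fin m → Fin c)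
    (L : List ((Fin m × Fin m × ℤ × ℤ) × List (ℤ × ℤ × ℤ)))
    (hpos : 0 < S ∧ 0 < A ∧ 0 < B) (hper : x + S < 2 * A ∧ y + S < 2 * B)
    (stacked : ∀ i, IsStacked (T i))
    (bounds : ∀ i, InBox (T i) (box i) ∧
      ((0 ≤ (box i).1.1 ∧ (box i).1.2 ≤ x) ∧ 0 ≤ (box i).2.1 ∧ (box i).2.2 ≤ y))
    (near : ∀ i, ∀ p ∈ T i, ∀ q ∈ T i, (p.1 - q.1) ^ 2 + (p.2.2 - q.2.1) ^ 2 < S ^ 2)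
    (separated : ∀ l ∈ L, SeparatedBy S (T l.1.1) (T l.1.2.1) (l.1.2.2.1 * A, l.1.2.2.2 * B) l.2)
    (covered : ∀ i j, color i = color j → ∀ n₁ ∈ Finset.Icc (-1 : ℤ) 1,
      ∀ n₂ ∈ Finset.Icc (-1 : ℤ) 1, (i = j ∧ n₁ = 0 ∧ n₂ = 0) ∨
        BoxesApart S (box i) (box j) (n₁ * A, n₂ * B) ∨
        (∃ l ∈ L, l.1 = (i, j, n₁, n₂)) ∨ ∃ l ∈ L, l.1 = (j, i, -n₁, -n₂))
    (apart : ∀ i j, i < j → color i ≠ color j → ∀ n₁ ∈ Finset.Icc (-1 : ℤ) 1,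
      ∀ n₂ ∈ Finset.Icc (-1 : ℤ) 1, BoxesApart 0 (box i) (box j) (n₁ * A, n₂ * B) ∨
        ∀ e ∈ consecutive (T i), ∀ f ∈ consecutive (T j), AreApart e f (n₁ * A, n₂ * B)) :
    Arrangement (Fin m) (Fin c) where
  S := S
  A := A
  B := B
  S_pos := hpos.1
  A_pos := hpos.2.1
  B_pos := hpos.2.2
  T := T
  color := color
  stacked := stacked
  near i := sq_add_sq_lt_of_opposite (stacked i) (near i)
  far := by
    rintro i j hij ⟨n₁, n₂⟩ hn
    by_cases hmem : n₁ ∈ Finset.Icc (-1) 1 ∧ n₂ ∈ Finset.Icc (-1) 1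
    · rcases covered i j hij n₁ hmem.1 n₂ hmem.2 with ⟨h1, h2, h3⟩ | h | ⟨l, hl, h⟩ | ⟨l, hl, h⟩
      · exact absurd ⟨h1, Prod.ext h2 h3⟩ hn
      · exact h.isFar hpos.1.le (bounds i).1 (bounds j).1
      · have := (separated l hl).isFar
        rwa [h] at this
      · have := (separated l hl).isFar.symm
        rw [h] at this
        simpa using this
    · exact (boxesApart_of_notMem hpos.2.1 hpos.2.2 hper.1 hper.2 (bounds i).2 (bounds j).2
        hmem).isFar hpos.1.le (bounds i).1 (bounds j).1
  apart := by
    rintro i j hij ⟨n₁, n₂⟩ e he f hf w hw hz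
    by_cases hmem : n₁ ∈ Finset.Icc (-1) 1 ∧ n₂ ∈ Finset.Icc (-1) 1
    · rcases lt_trichotomy i j with h | rfl | h
      · rcases apart i j h hij n₁ hmem.1 n₂ hmem.2 with h | h
        · exact (h.isFar le_rfl (bounds i).1 (bounds j).1).add_notMem ⟨f, hf, hw⟩ ⟨e, he, hz⟩
        · exact (h e he f hf).add_notMem hw hz
      · exact hij rfl
      -- The condition is listed only for `i < j`; the other order follows by translating back by
      -- the negated vector.
      · rw [Finset.mem_Icc, Finset.mem_Icc] at hmem
        have hw' : (w.1 + (n₁ * A : ℤ) + (-n₁ * A : ℤ),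
            w.2 + (n₂ * B : ℤ) + (-n₂ * B : ℤ)) = w := by
          simp
        rcases apart j i h hij.symm (-n₁) (Finset.mem_Icc.2 (by lia)) (-n₂)
          (Finset.mem_Icc.2 (by lia)) with h | h
        · refine (h.isFar le_rfl (bounds j).1 (bounds i).1).add_notMem ⟨e, he, hz⟩ ⟨f, hf, ?_⟩
          rwa [hw']
        · refine (h f hf e he).add_notMem hz ?_
          rwa [hw']
    · have := (boxesApart_of_notMem hpos.2.1 hpos.2.2 hper.1 hper.2 (bounds i).2 (bounds j).2
        hmem).isFar hpos.1.le (bounds i).1 (bounds j).1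
      exact this.add_notMem ⟨f, hf, hw⟩ ⟨e, he, hz⟩

/-! ### The ten tiles and the verification of their properties -/

/-- The cross sections of the ten tiles. -/
def tileSections : Fin 10 → List CrossSection := ![
  [(33788, 114239, 139115), (35619, 107712, 139938),
   (38860, 100839, 141396), (41688, 96605, 142669), (45646, 91850, 142805), (50873, 86587, 143075),
   (57053, 81236, 143538), (64178, 76203, 144168), (71273, 71840, 144940), (78586, 68351, 145847),
   (84591, 65816, 146890), (88918, 64118, 148069), (91570, 63179, 149384), (94324, 62872, 150836),
   (97144, 63998, 152409), (99033, 64753, 154059), (101893, 65894, 155738),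
   (105220, 70897, 157490), (110129, 77332, 159555), (112120, 84699, 159398),
   (116600, 92477, 159044), (119306, 100154, 158831), (123402, 107217, 154246),
   (127622, 113153, 146892), (130933, 117484, 137959)],
  [(116600, 265343, 270507), (119306, 259146, 277981),
   (123402, 258823, 285846), (127622, 258490, 293409), (130933, 258295, 300078),
   (132763, 258139, 305033), (133793, 257988, 305444), (136402, 257729, 306486),
   (139566, 257260, 307749), (142789, 256562, 307354), (145917, 255311, 306871),
   (152151, 253344, 306386), (159691, 250590, 305903), (167048, 247126, 305401),
   (173692, 243121, 304874), (180200, 238851, 304331), (185155, 234747, 303774),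
   (188933, 231494, 303190), (191355, 230966, 302548), (194288, 232286, 301802),
   (197148, 233573, 300900), (199037, 241226, 299806), (202436, 251127, 298506),
   (206767, 262397, 296936), (212124, 274101, 294917), (213743, 285282, 289063)],
  [(14976, 185003, 189074), (16595, 178198, 194928),
   (23654, 170856, 195046), (26368, 163458, 195091), (30135, 156501, 195030),
   (32759, 150443, 195057), (33788, 146039, 195089), (35619, 145259, 195173),
   (38860, 143877, 195403), (41688, 142672, 195872), (45646, 142808, 196810),
   (50873, 143078, 198336), (57053, 143541, 200523), (64178, 144171, 203366),
   (71273, 144943, 206750), (78586, 145850, 210445), (84591, 146893, 214132),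
   (88918, 148072, 217396), (91570, 149387, 219718), (94324, 150838, 218466),
   (97144, 152411, 217183), (99033, 154062, 209454), (101893, 155741, 199696),
   (105220, 157493, 188889), (110129, 159558, 177983), (112120, 165354, 168062)],
  [(132763, 310845, 337006), (133793, 310377, 340884),
   (136402, 309190, 347116), (139566, 307751, 352349), (142789, 307356, 356277),
   (145917, 306873, 361087), (152151, 306388, 366835), (159691, 305905, 372494),
   (167048, 305403, 377499), (173692, 304876, 381477), (180200, 304333, 384529),
   (185155, 303776, 386639), (188933, 303192, 388036), (191355, 302551, 388694),
   (194288, 301805, 387444), (197148, 300903, 386225), (199037, 299809, 385420),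
   (202436, 298509, 380523), (206767, 296938, 374210), (212124, 294919, 367039),
   (213743, 294946, 359477), (220802, 295065, 351977), (223516, 298017, 344996),
   (227283, 305400, 339014), (229907, 313286, 334565)],
  [(101893, 49660, 65892), (105220, 40737, 70895),
   (110129, 32187, 77329), (112120, 29720, 84697), (116600, 25174, 92475), (119306, 22668, 100151),
   (123402, 19874, 107214), (127622, 18352, 113151), (130933, 17900, 117482),
   (132763, 17759, 117624), (133793, 17727, 117656), (136402, 17693, 117690),
   (139566, 17858, 117525), (142789, 21786, 117193), (145917, 26596, 116662),
   (152151, 32343, 114688), (159691, 38003, 111327), (167048, 43007, 107577),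
   (173692, 46986, 104191), (180200, 50038, 100347), (185155, 52148, 96715),
   (188933, 53544, 93746), (191355, 54203, 90513), (194288, 55064, 86194), (197148, 55904, 80091),
   (199037, 56459, 73380)],
  [(0, 219756, 233571), (1889, 213046, 241224), (5288, 205675, 251124),
   (9619, 199578, 262394), (14976, 196847, 274098), (16595, 196413, 285280),
   (23654, 195305, 293117), (26368, 195094, 293914), (30135, 195032, 295020),
   (32759, 195059, 294887), (33788, 195092, 294787), (35619, 195176, 294584),
   (38860, 195405, 293900), (41688, 195874, 293211), (45646, 196812, 289194),
   (50873, 198338, 283890), (57053, 200525, 278571), (64178, 203369, 273711),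
   (71273, 206753, 268872), (78586, 210448, 264904), (84591, 214135, 262087),
   (88918, 217399, 260497), (91570, 219721, 256221), (94324, 222369, 251194),
   (97144, 226023, 243476)],
  [(97144, 217186, 233844), (99033, 209456, 240554),
   (101893, 199698, 246811), (105220, 188891, 252277), (110129, 177985, 254800),
   (112120, 168064, 255823), (116600, 162866, 257420), (119306, 159724, 257928),
   (123402, 158579, 258398), (127622, 158490, 258487), (130933, 158685, 258292),
   (132763, 158840, 258137), (133793, 158985, 257986), (136402, 159403, 257726),
   (139566, 160095, 257258), (142789, 163298, 256559), (145917, 167010, 255308),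
   (152151, 172064, 253341), (159691, 176965, 250587), (167048, 181778, 247123),
   (173692, 186130, 243118), (180200, 189413, 238849), (185155, 192194, 234745),
   (188933, 197581, 231492), (191355, 202132, 229068), (194288, 210124, 225055)],
  [(1889, 50928, 69170), (5288, 46032, 78261), (9619, 39718, 85887),
   (14976, 32547, 91214), (16595, 24985, 92823), (23654, 17486, 97441), (26368, 10505, 99217),
   (30135, 4522, 99728), (32759, 74, 99923), (33788, 16, 99980), (35619, 0, 99997),
   (38860, 111, 99885), (41688, 400, 96603), (45646, 1095, 91847), (50873, 2783, 86585),
   (57053, 5467, 81234), (64178, 9129, 76201), (71273, 12775, 71838), (78586, 16898, 68349),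
   (84591, 21188, 65813), (88918, 24968, 64115), (91570, 28585, 63176), (94324, 32741, 62869),
   (97144, 38739, 62081), (99033, 45450, 61581)],
  [(35619, 308285, 329176), (38860, 299517, 333407),
   (41688, 294434, 334315), (45646, 289196, 335586), (50873, 283892, 337274),
   (57053, 278574, 339958), (64178, 273714, 343620), (71273, 268874, 347267),
   (78586, 264907, 351389), (84591, 262089, 355679), (88918, 260500, 359459),
   (91570, 260189, 359770), (94324, 260021, 359938), (97144, 259981, 359978),
   (99033, 260052, 359907), (101893, 260307, 359652), (105220, 260831, 359159),
   (110129, 264043, 357599), (112120, 265345, 356967), (116600, 270510, 355542),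
   (119306, 277984, 354162), (123402, 285848, 352075), (127622, 293411, 345570),
   (130933, 300080, 338533), (132763, 305455, 332006)],
  [(133793, 122842, 144467), (136402, 119689, 152315),
   (139566, 118683, 158614), (142789, 117659, 163295), (145917, 116664, 167007),
   (152151, 114690, 172062), (159691, 111329, 176962), (167048, 107579, 181776),
   (173692, 104193, 186127), (180200, 100349, 189410), (185155, 96717, 192191),
   (188933, 93748, 192780), (191355, 93448, 193080), (194288, 93265, 193263),
   (197148, 93306, 193222), (199037, 93378, 193150), (202436, 93698, 192830),
   (206767, 94557, 189875), (212124, 96278, 185001), (213743, 97110, 178196),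
   (220802, 100738, 170853), (223516, 104281, 163456), (227283, 110600, 156499),
   (229907, 116869, 150440), (230936, 120747, 146036)]]

/-- Boxes that contain the ten tiles. -/
def tileBox : Fin 10 → (ℤ × ℤ) × ℤ × ℤ := ![
  ((33788, 130933), (62872, 159555)),
  ((116600, 213743), (230966, 307749)), ((14976, 112120), (142672, 219718)),
  ((132763, 229907), (294919, 388694)), ((101893, 199037), (17693, 117690)),
  ((0, 97144), (195032, 295020)), ((97144, 194288), (158490, 258487)), ((1889, 99033), (0, 99997)),
  ((35619, 132763), (259981, 359978)), ((133793, 230936), (93265, 193263))]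

/-- The colors of the ten tiles. -/
def tileColor : Fin 10 → Fin 5 := ![0, 0, 1, 1, 2, 2, 3, 3, 4, 4]

/-- Separating lines for the pairs of neighboring tiles of the same color. -/
def tileSeparators : List ((Fin 10 × Fin 10 × ℤ × ℤ) × List (ℤ × ℤ × ℤ)) := [
  ((0, 1, -1, -1), [(-14, -27, 858915)]),
  ((0, 1, -1, 0), [(-41, 91, 21255143)]),
  ((0, 1, 0, -1), [(371, -929, 76624342)]),
  ((1, 0, 0, 0), [(-20, -23, -6039233), (-79, -997, -167779681), (-5, -30, -5361460),
    (-16, -25, -5879671), (-9, -29, -5679853), (-34, -94, -18986518), (-13, -27, -5839415)]),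
  ((2, 3, -1, -1), [(-392, -920, -47593144)]),
  ((2, 3, -1, 0), [(-16, 25, 6998161), (-5, 300, 88400820), (-8, 29, 8367653),
    (-13, 27, 7659253), (-11, 28, 8001626), (-5, 30, 8733680)]),
  ((2, 3, 0, -1), [(15, -26, 1383822)]),
  ((2, 3, 0, 0), [(124, 273, 101322207)]),
  ((5, 4, 0, 1), [(71, 70, 33455360), (345, 939, 375325242), (20, 23, 10600846),
    (42, 91, 37430372), (48, 88, 37107680), (169, 248, 108738202), (564, 826, 362304396)]),
  ((4, 5, 0, 0), [(-15, 26, 4292858)]),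
  ((4, 5, 1, -1), [(223, -201, 57555623), (282, -959, 101946707), (10, -28, 3366576),
    (12, -28, 3808180), (17, -25, 4788059), (18, -24, 4967484), (154, -257, 44637397),
    (425, -905, 131287035)]),
  ((4, 5, 1, 0), [(136, 267, 81407013)]),
  ((7, 6, 0, 0), [(758, 653, 194732752), (81, 289, 55824022), (10, 28, 5665332),
    (16, 26, 6061720), (20, 23, 6059772), (21, 21, 5859630), (39, 92, 19347542),
    (43, 90, 19505318), (58, 82, 20017116), (77, 290, 55489864)]),
  ((6, 7, 0, 1), [(-457, 889, 276150380)]),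
  ((6, 7, 1, 0), [(705, -709, 84876694), (14, -27, 450365), (55, -84, 3958733),
    (19, -23, 1926188)]),
  ((6, 7, 1, 1), [(16, 26, 12377280)]),
  ((8, 9, -1, 0), [(-1691, -2478, -486775979)]),
  ((8, 9, -1, 1), [(-20, 23, 9537256), (-92, 286, 121823000), (-457, 889, 376111370),
    (-49, 87, 36706138), (-31, 95, 40459084), (-17, 24, 10043450), (-12, 28, 11881904)]),
  ((9, 8, 0, 0), [(-55, 84, 16122380), (-16, 25, 4837255)]),
  ((9, 8, 0, -1), [(-19, -24, -2766582), (-91, -286, -16630328),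
    (-136, -267, -21477416), (-15, -26, -2308136), (-12, -27, -1967496)])]

theorem tileSections_stacked (i : Fin 10) : IsStacked (tileSections i) := by
  revert i; decide +kernel

theorem tileSections_bounds (i : Fin 10) :
    InBox (tileSections i) (tileBox i) ∧ ((0 ≤ (tileBox i).1.1 ∧ (tileBox i).1.2 ≤ 230936) ∧
      0 ≤ (tileBox i).2.1 ∧ (tileBox i).2.2 ≤ 388694) := by
  revert i; decide +kernel

theorem tileSections_near (i : Fin 10) :
    ∀ p ∈ tileSections i, ∀ q ∈ tileSections i,
      (p.1 - q.1) ^ 2 + (p.2.2 - q.2.1) ^ 2 < 100000 ^ 2 := by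
  revert i; decide +kernel

theorem tileSections_separated :
    ∀ l ∈ tileSeparators, SeparatedBy 100000 (tileSections l.1.1) (tileSections l.1.2.1)
      (l.1.2.2.1 * 197148, l.1.2.2.2 * 334494) l.2 := by
  decide +kernel

/-- A tile and its own translates need no separating line: no tile extends more than 97145 in the
first coordinate, so a shift by 197148 leaves a gap above 100000, and the second period is larger
still. -/
theorem tileSeparators_covered (i j : Fin 10) : tileColor i = tileColor j →
    ∀ n₁ ∈ Finset.Icc (-1 : ℤ) 1, ∀ n₂ ∈ Finset.Icc (-1 : ℤ) 1, (i = j ∧ n₁ = 0 ∧ n₂ = 0) ∨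
      BoxesApart 100000 (tileBox i) (tileBox j) (n₁ * 197148, n₂ * 334494) ∨
      (∃ l ∈ tileSeparators, l.1 = (i, j, n₁, n₂)) ∨
        ∃ l ∈ tileSeparators, l.1 = (j, i, -n₁, -n₂) := by
  revert i j; decide +kernel

/-- Neighboring tiles are cut at common levels modulo the first period, so overlapping level ranges
coincide and comparing end points suffices. -/
theorem tileSections_apart (i j : Fin 10) : i < j → tileColor i ≠ tileColor j →
    ∀ n₁ ∈ Finset.Icc (-1 : ℤ) 1, ∀ n₂ ∈ Finset.Icc (-1 : ℤ) 1,
      BoxesApart 0 (tileBox i) (tileBox j) (n₁ * 197148, n₂ * 334494) ∨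
      ∀ e ∈ consecutive (tileSections i), ∀ f ∈ consecutive (tileSections j),
        AreApart e f (n₁ * 197148, n₂ * 334494) := by
  revert i j; decide +kernel

/-- The density bound 0.037356 with denominators cleared; the factor 2 comes from the doubled areas.
-/
theorem lt_sum_doubleArea :
    2 * (1000000 - 37356) * (197148 * 334494) < 1000000 * ∑ i, doubleArea (tileSections i) := by
  decide +kernel

/-- The arrangement of the ten tiles. -/
def tileArrangement : Arrangement (Fin 10) (Fin 5) :=
  .ofList 100000 197148 334494 230936 388694 tileSections tileBox tileColor tileSeparators
    (by norm_num) (by norm_num) tileSections_stacked tileSections_bounds tileSections_near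
    tileSections_separated tileSeparators_covered tileSections_apart

theorem mainTheorem3 :
    ∃ f : PartialColoring 5,
      f.AvoidsUnitDistance ∧
      (∃ v w : Plane, LinearIndependent ℝ ![v, w] ∧ f.IsPeriodic v w ∧
        ∃ k l : ℕ, 0 < k ∧ 0 < l ∧ f.IsConstantOnCells v w k l) ∧
      ∃ d : ℝ, HasDensity f.removed d ∧ d ≤ 0.037356 := by
  refine tileArrangement.exists_coloring ?_
  have h : (2 * (1000000 - 37356) * (197148 * 334494) : ℝ) <
      1000000 * (∑ i, doubleArea (tileSections i) : ℤ) := by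
    exact_mod_cast lt_sum_doubleArea
  simp only [tileArrangement, Arrangement.ofList]
  push_cast at h ⊢
  linarith
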